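/- All graphs are finite, simple, undirected and connected; $d$ denotes the shortest-path distance. A geodesic triangle of a graph $G=(V,E)$ consists of three vertices $x,y,z\in V$ and three shortest paths $P(x,y)$, $P(x,z)$, $P(y,z)$ joining them pairwise. It is $\delta$-slim if every vertex on any one of the three paths is at distance at most $\delta$ from the union of the other two. The slimness $sl(G)$ is the smallest $\delta\ge 0$ such that all geodesic triangles of $G$ are $\delta$-slim. A hole is an induced cycle of length at least $5$; a house is a $4$-cycle together with a fifth vertex adjacent to exactly two adjacent vertices of the cycle; a domino is a $6$-cycle with exactly one chord, which divides it into two $4$-cycles. A graph is HHD-free (house-hole-domino-free) if it contains no hole, no house and no domino as an induced subgraph. Then $sl(G)\le 1$ for every HHD-free graph $G$. -/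

import Mathlib

open scoped NNReal ENNReal

namespace SimpleGraph

variable {V : Type*}

/-- A walk is a shortest path when its length is the distance between its ends. -/
def Walk.IsShortestPath {G : SimpleGraph V} {x y : V} (p : G.Walk x y) : Prop :=
  p.length = G.dist x y

/-- The distance from `u` to the vertex set `M` is at most `δ`:
some vertex of `M` is at distance at most `δ` from `u`. -/
def DistToSetLE (G : SimpleGraph V) (u : V) (M : Set V) (δ : ℝ≥0) : Prop :=
  ∃ v ∈ M, (G.dist u v : ℝ≥0) ≤ δ

/-- The triangle with sides `p`, `q`, `r` is `δ`-slim: each vertex of a side is at distance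
at most `δ` from the union of the two other sides. -/
def IsSlimTriangle (G : SimpleGraph V) {x y z : V}
    (p : G.Walk x y) (q : G.Walk x z) (r : G.Walk y z) (δ : ℝ≥0) : Prop :=
  (∀ u ∈ p.support, G.DistToSetLE u {v | v ∈ q.support ∨ v ∈ r.support} δ) ∧
  (∀ u ∈ q.support, G.DistToSetLE u {v | v ∈ p.support ∨ v ∈ r.support} δ) ∧
  (∀ u ∈ r.support, G.DistToSetLE u {v | v ∈ p.support ∨ v ∈ q.support} δ)

/-- A graph is `δ`-slim if all its geodesic triangles are `δ`-slim. -/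
def IsSlim (G : SimpleGraph V) (δ : ℝ≥0) : Prop :=
  ∀ (x y z : V) (p : G.Walk x y) (q : G.Walk x z) (r : G.Walk y z),
    p.IsShortestPath → q.IsShortestPath → r.IsShortestPath → G.IsSlimTriangle p q r δ

/-- The slimness of a graph: the least `δ` for which it is `δ`-slim
(`∞` if there is none, which does not happen for finite graphs). -/
noncomputable def slimness (G : SimpleGraph V) : ℝ≥0∞ :=
  ⨅ (δ : ℝ≥0) (_ : G.IsSlim δ), (δ : ℝ≥0∞)

/-- The house: the 4-cycle `0, 2, 3, 4` and the triangle `0, 1, 2`, sharing the edge `0 2`. -/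
def house : SimpleGraph (Fin 5) :=
  cycleGraph 5 ⊔ edge 0 2

/-- The domino: the 6-cycle with one chord dividing it into two 4-cycles. -/
def domino : SimpleGraph (Fin 6) :=
  cycleGraph 6 ⊔ edge 0 3

/-- House-hole-domino-free: there is no induced cycle of length at least 5, no induced house
and no induced domino. -/
structure IsHHDFree (G : SimpleGraph V) : Prop where
  hole_free : ∀ k : ℕ, 5 ≤ k → ¬ (cycleGraph k).IsIndContained G
  house_free : ¬ house.IsIndContained G
  domino_free : ¬ domino.IsIndContained G

/-- The slimness is attained as soon as it is finite: it is at most a natural number `n`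
exactly when the graph is `n`-slim. -/
theorem slimness_le_natCast_iff (G : SimpleGraph V) (n : ℕ) :
    G.slimness ≤ n ↔ G.IsSlim n := by
  constructor
  · intro h
    have h1 : G.slimness < ((n + 1 : ℝ≥0) : ℝ≥0∞) := by
      refine lt_of_le_of_lt h ?_
      exact_mod_cast (lt_add_one n)
    simp only [slimness, iInf_lt_iff] at h1
    obtain ⟨δ, hδ, hlt⟩ := h1
    have hlt' : δ < n + 1 := by exact_mod_cast hlt
    have key : ∀ u M, G.DistToSetLE u M δ → G.DistToSetLE u M n := by
      rintro u M ⟨v, hv, hd⟩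
      refine ⟨v, hv, ?_⟩
      have h2 : (G.dist u v : ℝ≥0) < ((n + 1 : ℕ) : ℝ≥0) := by
        push_cast
        exact lt_of_le_of_lt hd hlt'
      have h3 : G.dist u v < n + 1 := by exact_mod_cast h2
      exact_mod_cast Nat.lt_succ_iff.mp h3
    intro x y z p q r hp hq hr
    obtain ⟨a, b, c⟩ := hδ x y z p q r hp hq hr
    exact ⟨fun u hu => key _ _ (a u hu), fun u hu => key _ _ (b u hu),
      fun u hu => key _ _ (c u hu)⟩
  · intro h
    exact iInf₂_le_of_le (n : ℝ≥0) h (by simp)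

end SimpleGraph

/-!
Suppose a vertex `u` of a geodesic side `p` from `x` to `y` had no vertex of the two other sides
`q`, `r` in its closed neighbourhood. Let `a` and `b` be the vertices of `p` just before and just
after `u`. Going back along `p` from `a` to `x`, along `q` and `r` to `y`, and back along `p` to
`b`, one joins `a` to `b` without meeting the closed neighbourhood of `u` in between. A shortest
such connection, closed up through `u`, is an induced cycle; as there are no holes it is a
4-cycle `a, u, b, c` (`exists_adj_adj_of_walk`). The vertex `c` cannot lie on `p`, so it lies on
`q` or `r`; by symmetry take `q`. Since `c` is adjacent to both `a` and `b`, it is as far from `x`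
as `u` is.

Let `a'` be the predecessor of `c` on `q`; it is as far from `x` as `a`. If `a` and `a'` are
adjacent, then `a, a', c, b, u` is a house. Otherwise the same hole-freeness argument, with `c` in
the role of `u` and geodesics to `x` as the connection, gives a common neighbour `e` of `a` and
`a'` closer to `x`, and `a, u, b, c, a', e` is a domino (`not_isHHDFree_of_geodesic_fork`).
-/

namespace SimpleGraph

variable {V : Type*} {G : SimpleGraph V}

/-! ### Recognising induced subgraphs -/

theorem isIndContained_of_injective_of_lt {α : Type*} [LinearOrder α] {H : SimpleGraph α}
    (f : α → V) (hf : Function.Injective f)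
    (h : ∀ i j, i < j → (G.Adj (f i) (f j) ↔ H.Adj i j)) : H.IsIndContained G := by
  refine ⟨⟨⟨f, hf⟩, ?_⟩⟩
  intro i j
  change G.Adj (f i) (f j) ↔ _
  rcases lt_trichotomy i j with hij | rfl | hij
  · exact h i j hij
  · simp
  · rw [G.adj_comm, H.adj_comm]
    exact h j i hij

/-- If no two vertices of `H` have the same neighbours, a map that preserves and reflects
adjacency is automatically injective. -/
theorem isIndContained_of_twinFree {α : Type*} [LinearOrder α] {H : SimpleGraph α}
    (htwin : ∀ i j, (∀ k, H.Adj i k ↔ H.Adj j k) → i = j) (f : α → V)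
    (h : ∀ i j, i < j → (G.Adj (f i) (f j) ↔ H.Adj i j)) : H.IsIndContained G := by
  have h' : ∀ i j, G.Adj (f i) (f j) ↔ H.Adj i j := by
    intro i j
    rcases lt_trichotomy i j with hij | rfl | hij
    · exact h i j hij
    · simp
    · rw [G.adj_comm, H.adj_comm]
      exact h j i hij
  refine isIndContained_of_injective_of_lt f (fun i j hij => htwin i j fun k => ?_) h
  rw [← h', ← h', hij]

theorem house_isIndContained {v₀ v₁ v₂ v₃ v₄ : V}
    (h01 : G.Adj v₀ v₁) (h12 : G.Adj v₁ v₂) (h23 : G.Adj v₂ v₃) (h34 : G.Adj v₃ v₄)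
    (h04 : G.Adj v₀ v₄) (h02 : G.Adj v₀ v₂)
    (h03 : ¬ G.Adj v₀ v₃) (h13 : ¬ G.Adj v₁ v₃) (h14 : ¬ G.Adj v₁ v₄) (h24 : ¬ G.Adj v₂ v₄) :
    house.IsIndContained G := by
  refine isIndContained_of_twinFree ?_ ![v₀, v₁, v₂, v₃, v₄] ?_
  · simp only [house, sup_adj, cycleGraph_adj, edge_adj]
    decide
  · intro i j hij
    simp only [house, sup_adj, cycleGraph_adj, edge_adj]
    fin_cases i <;> fin_cases j <;> simp_all <;> decide

theorem domino_isIndContained {v₀ v₁ v₂ v₃ v₄ v₅ : V}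
    (h01 : G.Adj v₀ v₁) (h12 : G.Adj v₁ v₂) (h23 : G.Adj v₂ v₃) (h34 : G.Adj v₃ v₄)
    (h45 : G.Adj v₄ v₅) (h05 : G.Adj v₀ v₅) (h03 : G.Adj v₀ v₃)
    (h02 : ¬ G.Adj v₀ v₂) (h04 : ¬ G.Adj v₀ v₄) (h13 : ¬ G.Adj v₁ v₃) (h14 : ¬ G.Adj v₁ v₄)
    (h15 : ¬ G.Adj v₁ v₅) (h24 : ¬ G.Adj v₂ v₄) (h25 : ¬ G.Adj v₂ v₅) (h35 : ¬ G.Adj v₃ v₅) :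
    domino.IsIndContained G := by
  refine isIndContained_of_twinFree ?_ ![v₀, v₁, v₂, v₃, v₄, v₅] ?_
  · simp only [domino, sup_adj, cycleGraph_adj, edge_adj]
    decide
  · intro i j hij
    simp only [domino, sup_adj, cycleGraph_adj, edge_adj]
    fin_cases i <;> fin_cases j <;> simp_all <;> decide

theorem cycleGraph_adj_iff_of_lt {n : ℕ} {i j : Fin n} (hij : i < j) :
    (cycleGraph n).Adj i j ↔ j.val = i.val + 1 ∨ (i.val = 0 ∧ j.val + 1 = n) := by
  have h1 : (i - j).val = n + i - j := Fin.coe_sub_iff_lt.mpr hij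
  have h2 : (j - i).val = j - i := Fin.coe_sub_iff_le.mpr hij.le
  rw [cycleGraph_adj', h1, h2]
  have : i.val < j.val := hij
  omega

/-! ### Shortest walks -/

theorem Walk.IsShortestPath.reverse {x y : V} {p : G.Walk x y} (hp : p.IsShortestPath) :
    p.reverse.IsShortestPath := by
  simpa [Walk.IsShortestPath, dist_comm] using hp

theorem Walk.IsShortestPath.takeUntil [DecidableEq V] {x y u : V} {p : G.Walk x y}
    (hp : p.IsShortestPath) (hu : u ∈ p.support) : (p.takeUntil u hu).IsShortestPath :=
  length_eq_dist_of_subwalk hp (p.isSubwalk_takeUntil hu)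

theorem Walk.IsShortestPath.dist_add_dist {x y u : V} {p : G.Walk x y}
    (hp : p.IsShortestPath) (hu : u ∈ p.support) : G.dist x u + G.dist u y = G.dist x y := by
  classical
  have h1 : (p.takeUntil u hu).length = G.dist x u := hp.takeUntil hu
  have h2 : (p.dropUntil u hu).length = G.dist u y :=
    length_eq_dist_of_subwalk hp (p.isSubwalk_dropUntil hu)
  have h3 := congrArg Walk.length (p.take_spec hu)
  rw [Walk.length_append] at h3
  have h4 : p.length = G.dist x y := hp
  omega

theorem Walk.IsShortestPath.eq_of_dist_le {x y u : V} {p : G.Walk x y}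
    (hp : p.IsShortestPath) (hu : u ∈ p.support) (h : G.dist x y ≤ G.dist x u) : u = y := by
  classical
  have h1 := hp.dist_add_dist hu
  exact (p.dropUntil u hu).reachable.dist_eq_zero_iff.mp (by omega)

/-- Splitting off the last edge of a shortest path. -/
theorem Walk.IsShortestPath.exists_penultimate {x u : V} {p : G.Walk x u}
    (hp : p.IsShortestPath) (hne : x ≠ u) :
    ∃ (a : V) (s : G.Walk x a), G.Adj a u ∧ G.dist x u = G.dist x a + 1 ∧ s.IsShortestPath ∧
      ∀ v ∈ s.support, v ∈ p.support := by
  have hnil : ¬ p.Nil := Walk.not_nil_of_ne hne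
  have hadj := p.adj_penultimate hnil
  have hsub : p.dropLast.IsSubwalk p := ⟨.nil, .cons hadj .nil, by
    simpa [Walk.concat_eq_append] using (p.concat_dropLast hadj).symm⟩
  have hs : p.dropLast.length = G.dist x p.penultimate := length_eq_dist_of_subwalk hp hsub
  have hlen := congrArg Walk.length (p.concat_dropLast hadj)
  have hp' : p.length = G.dist x u := hp
  rw [Walk.length_concat] at hlen
  exact ⟨p.penultimate, p.dropLast, hadj, by omega, hs, fun v hv => hsub.support_subset hv⟩

/-- A chord of a shortest walk joins consecutive vertices. -/
theorem Walk.IsShortestPath.adj_getVert_iff {x y : V} {p : G.Walk x y}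
    (hp : p.IsShortestPath) {i j : ℕ} (hij : i < j) (hj : j ≤ p.length) :
    G.Adj (p.getVert i) (p.getVert j) ↔ j = i + 1 := by
  constructor
  · intro h
    have h1 := G.dist_le ((p.take i).append (.cons h (p.drop j)))
    have h2 : p.length = G.dist x y := hp
    simp only [Walk.length_append, Walk.length_cons, Walk.take_length, Walk.drop_length] at h1
    omega
  · rintro rfl
    exact p.adj_getVert_succ (by omega)

theorem Connected.dist_le_dist_add_one_of_adj (hG : G.Connected) {x v w : V} (h : G.Adj v w) :
    G.dist x w ≤ G.dist x v + 1 := by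
  have h1 := hG.dist_triangle (u := x) (v := v) (w := w)
  rw [dist_eq_one_iff_adj.mpr h] at h1
  exact h1

/-! ### Closing up a path through a vertex in a hole-free graph -/

/-- In a hole-free graph, let `a` and `b` be non-adjacent neighbours of `u`, joined by a walk all
of whose other vertices lie outside the closed neighbourhood of `u`. Then some vertex of the walk
completes `a, u, b` to a 4-cycle: a shortest walk from `a` to `b` through vertices of the given
one closes up through `u` to an induced cycle. -/
theorem exists_adj_adj_of_walk (hole : ∀ k : ℕ, 5 ≤ k → ¬ (cycleGraph k).IsIndContained G)
    {a b u : V} (hab : a ≠ b) (hnab : ¬ G.Adj a b) (hua : G.Adj a u) (hub : G.Adj b u)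
    (p : G.Walk a b) (hp : ∀ v ∈ p.support, v = a ∨ v = b ∨ (v ≠ u ∧ ¬ G.Adj v u)) :
    ∃ c ∈ p.support, c ≠ u ∧ ¬ G.Adj c u ∧ G.Adj a c ∧ G.Adj c b := by
  -- A shortest walk from `a` to `b` in the subgraph induced by the vertices of `p`.
  obtain ⟨n, f, h0, hl, hmem, hadj, hinj⟩ : ∃ (n : ℕ) (f : ℕ → V), f 0 = a ∧ f n = b ∧
      (∀ i, f i ∈ p.support) ∧
      (∀ {i j : ℕ}, i < j → j ≤ n → (G.Adj (f i) (f j) ↔ j = i + 1)) ∧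
      ∀ {i j : ℕ}, i ≤ n → j ≤ n → f i = f j → i = j := by
    obtain ⟨w, hw⟩ :=
      (p.induce {v | v ∈ p.support} fun v hv => hv).reachable.exists_walk_length_eq_dist
    exact ⟨w.length, fun i => (w.getVert i).1, by simp, by simp, fun i => (w.getVert i).2,
      fun hij hj => Walk.IsShortestPath.adj_getVert_iff hw hij hj, fun hi hj h =>
        (w.isPath_of_length_eq_dist hw).getVert_injOn hi hj (Subtype.ext h)⟩
  have hpos : n ≠ 0 := fun h => hab (by rw [← h0, ← hl, h])
  have hone : n ≠ 1 := fun h => hnab (by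
    rw [← h0, ← hl]
    exact (hadj (by omega) le_rfl).mpr (by omega))
  have hint : ∀ {i : ℕ}, 0 < i → i < n → f i ≠ u ∧ ¬ G.Adj (f i) u := by
    intro i hi hi'
    rcases hp _ (hmem i) with h | h | h
    · rw [← h0] at h
      have := hinj hi'.le (Nat.zero_le _) h
      omega
    · rw [← hl] at h
      have := hinj hi'.le le_rfl h
      omega
    · exact h
  by_cases htwo : n = 2
  · refine ⟨f 1, hmem 1, (hint (by omega) (by omega)).1,
      (hint (by omega) (by omega)).2, ?_, ?_⟩
    · rw [← h0]
      exact (hadj (by omega) (by omega)).mpr rfl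
    · rw [← hl]
      exact (hadj (by omega) le_rfl).mpr htwo
  · exfalso
    have hne : ∀ i, i ≤ n → f i ≠ u := by
      intro i hi h
      rcases Nat.eq_zero_or_pos i with rfl | hi0
      · exact hua.ne (h0.symm.trans h)
      rcases hi.eq_or_lt with rfl | hi1
      · exact hub.ne (hl.symm.trans h)
      exact (hint hi0 hi1).1 h
    -- The hole: the vertices of the shortest walk in order, followed by `u`.
    refine hole (n + 2) (by omega) (isIndContained_of_injective_of_lt
      (fun i => if i.val ≤ n then f i.val else u) ?_ ?_)
    · intro i j hij
      have hi := i.2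
      have hj := j.2
      ext
      dsimp only at hij
      split_ifs at hij with h1 h2 h2
      · exact hinj h1 h2 hij
      · exact absurd hij (hne _ h1)
      · exact absurd hij.symm (hne _ h2)
      · omega
    · intro i j hij
      have hij' : i.val < j.val := hij
      have hj := j.2
      rw [cycleGraph_adj_iff_of_lt hij, if_pos (show i.val ≤ n by omega)]
      split_ifs with h2
      · rw [hadj hij' h2]
        omega
      · rcases Nat.eq_zero_or_pos i.val with hi0 | hi0
        · rw [hi0, h0]
          exact iff_of_true hua (by omega)
        rcases (show i.val ≤ n by omega).eq_or_lt with hi1 | hi1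
        · rw [hi1, hl]
          exact iff_of_true hub (by omega)
        · exact iff_of_false (hint hi0 hi1).2 (by omega)

/-! ### The forbidden fork of geodesics -/

/-- Let `u` and `c` be at the same distance from `x`, with a common neighbour `a` one step closer
to `x` and a common neighbour `b` one step further away. If the graph is HHD-free, no geodesic
from `x` through `c` avoids the closed neighbourhood of `u`. -/
theorem not_isHHDFree_of_geodesic_fork (hconn : G.Connected) {x z a b c u : V}
    (hau : G.Adj a u) (hbu : G.Adj b u) (hac : G.Adj a c) (hcb : G.Adj c b)
    (hda : G.dist x u = G.dist x a + 1) (hdb : G.dist x b = G.dist x u + 1)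
    (q : G.Walk x z) (hq : q.IsShortestPath) (hc : c ∈ q.support)
    (havoid : ∀ v ∈ q.support, v ≠ u ∧ ¬ G.Adj v u) : ¬ G.IsHHDFree := by
  classical
  intro hG
  have hlev {v w : V} (h : G.Adj v w) : G.dist x w ≤ G.dist x v + 1 :=
    hconn.dist_le_dist_add_one_of_adj h
  have hdc : G.dist x c = G.dist x u := by
    have h1 := hlev hac
    have h2 := hlev hcb
    omega
  have hxc : x ≠ c := by
    rintro rfl
    rw [dist_self] at hdc
    omega
  obtain ⟨a', s, ha'c, hda', hs, hsub⟩ := (hq.takeUntil hc).exists_penultimate hxc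
  have hsub' : ∀ v ∈ s.support, v ∈ q.support := fun v hv =>
    q.support_takeUntil_subset_support hc (hsub v hv)
  have ha' := havoid a' (hsub' _ s.end_mem_support)
  have hcu := (havoid c hc).2
  have hab : ¬ G.Adj a b := fun h => by
    have := hlev h
    omega
  have ha'b : ¬ G.Adj a' b := fun h => by
    have := hlev h
    omega
  by_cases haa' : G.Adj a a'
  · exact hG.house_free (house_isIndContained haa' ha'c hcb hbu hau hac hab ha'b ha'.2 hcu)
  have hne : a ≠ a' := by
    rintro rfl
    exact ha'.2 hau
  obtain ⟨t, ht⟩ := hconn.exists_walk_length_eq_dist x a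
  -- Vertices of the geodesics from `x` other than their ends are too close to `x` to be `c` or
  -- to be adjacent to `c`.
  have hfar {v : V} (hv : G.dist x v < G.dist x a) : v ≠ c ∧ ¬ G.Adj v c := by
    refine ⟨?_, fun h => ?_⟩
    · rintro rfl
      omega
    · have := hlev h
      omega
  have hwalk : ∀ v ∈ (t.reverse.append s).support, v = a ∨ v = a' ∨ G.dist x v < G.dist x a := by
    intro v hv
    rw [Walk.mem_support_append_iff, Walk.support_reverse, List.mem_reverse] at hv
    by_contra! h
    rcases hv with hv | hv
    · exact h.1 (Walk.IsShortestPath.eq_of_dist_le ht hv h.2.2)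
    · exact h.2.1 (hs.eq_of_dist_le hv (by omega))
  obtain ⟨e, he, hec, hnec, hae, hea'⟩ := exists_adj_adj_of_walk hG.hole_free hne haa' hac ha'c
    (t.reverse.append s) fun v hv => (hwalk v hv).imp_right (Or.imp_right hfar)
  have hde : G.dist x e < G.dist x a := by
    rcases hwalk e he with rfl | rfl | h
    · exact absurd hae (G.irrefl)
    · exact absurd hea' (G.irrefl)
    · exact h
  exact hG.domino_free (domino_isIndContained hau hbu.symm hcb.symm ha'c.symm hea'.symm hae hac
    hab haa' (fun h => hcu h.symm) (fun h => ha'.2 h.symm)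
    (fun h => by
      have := hlev h.symm
      omega)
    (fun h => ha'b h.symm)
    (fun h => by
      have := hlev h.symm
      omega)
    (fun h => hnec h.symm))

/-! ### Slimness of geodesic triangles -/

/-- A geodesic from `x` to `u ≠ x`: the neighbour of `u` on it, and the part up to that neighbour,
which otherwise avoids the closed neighbourhood of `u`. -/
theorem Walk.IsShortestPath.exists_penultimate_avoiding (hconn : G.Connected) {x u : V}
    {p : G.Walk x u} (hp : p.IsShortestPath) (hne : x ≠ u) :
    ∃ (a : V) (s : G.Walk x a), G.Adj a u ∧ G.dist x u = G.dist x a + 1 ∧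
      ∀ v ∈ s.support, v ∈ p.support ∧ (v = a ∨ (v ≠ u ∧ ¬ G.Adj v u)) := by
  obtain ⟨a, s, hau, hd, hs, hsub⟩ := hp.exists_penultimate hne
  refine ⟨a, s, hau, hd, fun v hv => ⟨hsub v hv, ?_⟩⟩
  have h1 := hs.dist_add_dist hv
  refine or_iff_not_imp_left.mpr fun hva => ⟨?_, fun h => hva (hs.eq_of_dist_le hv ?_)⟩
  · rintro rfl
    omega
  · have := hconn.dist_le_dist_add_one_of_adj (x := x) h
    omega

theorem IsHHDFree.exists_eq_or_adj_of_geodesic_triangle (hconn : G.Connected) (hG : G.IsHHDFree)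
    {x y z : V} {p : G.Walk x y} {q : G.Walk x z} {r : G.Walk y z} (hp : p.IsShortestPath)
    (hq : q.IsShortestPath) (hr : r.IsShortestPath) {u : V} (hu : u ∈ p.support) :
    ∃ v, (v ∈ q.support ∨ v ∈ r.support) ∧ (v = u ∨ G.Adj v u) := by
  classical
  by_contra! hno
  have hxu : x ≠ u := (hno x (Or.inl q.start_mem_support)).1
  have hyu : y ≠ u := (hno y (Or.inr r.start_mem_support)).1
  have hur : u ∈ p.reverse.support := by simpa using hu
  obtain ⟨a, s, hau, hda, hs⟩ := (hp.takeUntil hu).exists_penultimate_avoiding hconn hxu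
  obtain ⟨b, t, hbu, hdb, ht⟩ := (hp.reverse.takeUntil hur).exists_penultimate_avoiding hconn hyu
  have hsp : ∀ v ∈ s.support, v ∈ p.support := fun v hv =>
    p.support_takeUntil_subset_support hu (hs v hv).1
  have htp : ∀ v ∈ t.support, v ∈ p.support := fun v hv => by
    simpa using p.reverse.support_takeUntil_subset_support hur (ht v hv).1
  have hsum {v : V} (hv : v ∈ p.support) : G.dist x v + G.dist y v = G.dist x y := by
    rw [G.dist_comm (u := y)]
    exact hp.dist_add_dist hv
  have hsu := hsum hu
  have hsa := hsum (hsp a s.end_mem_support)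
  have hsb := hsum (htp b t.end_mem_support)
  have hlev {w v v' : V} (h : G.Adj v v') : G.dist w v' ≤ G.dist w v + 1 :=
    hconn.dist_le_dist_add_one_of_adj h
  have hab : a ≠ b := by
    rintro rfl
    omega
  have hnab : ¬ G.Adj a b := fun h => by
    have := hlev (w := x) h
    omega
  obtain ⟨c, hc, hcu, hncu, hac, hcb⟩ := exists_adj_adj_of_walk hG.hole_free hab hnab hau hbu
    (s.reverse.append (q.append (r.reverse.append t))) (by
      intro v hv
      simp only [Walk.mem_support_append_iff, Walk.support_reverse, List.mem_reverse] at hv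
      rcases hv with hv | hv | hv | hv
      · exact (hs v hv).2.imp_right Or.inr
      · exact Or.inr (Or.inr (hno v (Or.inl hv)))
      · exact Or.inr (Or.inr (hno v (Or.inr hv)))
      · exact Or.inr ((ht v hv).2))
  have hca := hlev (w := x) hac
  have hcb' := hlev (w := x) hcb
  have hca' := hlev (w := y) hac.symm
  have hcb'' := hlev (w := y) hcb.symm
  simp only [Walk.mem_support_append_iff, Walk.support_reverse, List.mem_reverse] at hc
  rcases hc with hc | hc | hc | hc
  -- On `p`, only `u` itself is at the distance of `u` from `x` and from `y`.
  · exact hcu ((hp.takeUntil hu).eq_of_dist_le (hs c hc).1 (by omega))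
  · exact not_isHHDFree_of_geodesic_fork hconn hau hbu hac hcb hda (by omega) q hq hc
      (fun v hv => hno v (Or.inl hv)) hG
  · exact not_isHHDFree_of_geodesic_fork hconn hbu hau hcb.symm hac.symm hdb (by omega) r hr hc
      (fun v hv => hno v (Or.inr hv)) hG
  · exact hcu ((hp.reverse.takeUntil hur).eq_of_dist_le (ht c hc).1 (by omega))

theorem IsHHDFree.isSlim_one (hconn : G.Connected) (hG : G.IsHHDFree) : G.IsSlim 1 := by
  have key : ∀ {x y z : V} {p : G.Walk x y} {q : G.Walk x z} {r : G.Walk y z},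
      p.IsShortestPath → q.IsShortestPath → r.IsShortestPath → ∀ u ∈ p.support,
      G.DistToSetLE u {v | v ∈ q.support ∨ v ∈ r.support} 1 := by
    intro x y z p q r hp hq hr u hu
    obtain ⟨v, hv, huv⟩ := hG.exists_eq_or_adj_of_geodesic_triangle hconn hp hq hr hu
    refine ⟨v, hv, ?_⟩
    rcases huv with rfl | h
    · simp
    · simp [dist_eq_one_iff_adj.mpr h.symm]
  intro x y z p q r hp hq hr
  refine ⟨key hp hq hr, fun u hu => ?_, fun u hu => ?_⟩
  · simpa using key hq hp hr.reverse u hu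
  · simpa using key hr hp.reverse hq.reverse u hu

end SimpleGraph

theorem mainTheorem3 {V : Type*} [Finite V] (G : SimpleGraph V) (hconn : G.Connected)
    (hG : G.IsHHDFree) : G.slimness ≤ 1 := by
  have h := (SimpleGraph.slimness_le_natCast_iff G 1).mpr (by exact_mod_cast hG.isSlim_one hconn)
  exact_mod_cast h
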